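/- Let $K$ be a field, let $n_1<n_2<n_3<n_4$ be positive integers with $\gcd(n_1,\dots,n_4)=1$, and let $C$ be the monomial curve in $\mathbb{A}^4(K)$ with parametrization $x_i=t^{n_i}$. Let $I(C)$ be its toric ideal, i.e. the kernel of $K[x_1,\dots,x_4]\to K[t]$, $x_i\mapsto t^{n_i}$, and let $\mathcal{S}=\sum_i\mathbb{N}n_i$. For a monomial $\mathbf{x}^{\mathbf{u}}$ write $\deg(\mathbf{x}^{\mathbf{u}})=\sum_i u_i$ and $\operatorname{supp}(\mathbf{x}^{\mathbf{u}})=\{i : x_i \text{ divides } \mathbf{x}^{\mathbf{u}}\}$. For each $i$ let $a_i$ be the least positive integer with $a_in_i\in\sum_{j\ne i}\mathbb{N}n_j$; a binomial $x_i^{a_i}-\mathbf{x}^{\mathbf{u}}\in I(C)$ with $i\notin\operatorname{supp}(\mathbf{x}^{\mathbf{u}})$ is called critical with respect to $x_i$, and $\mathcal{C}_A$ is the ideal generated by all critical binomials. Assume that $a_in_i\ne a_jn_j$ for all $i\ne j$, and let the critical binomials $$x_1^{a_1}-\mathbf{x}^{\mathbf{u}},\quad x_2^{a_2}-\mathbf{x}^{\mathbf{v}},\quad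 x_3^{a_3}-\mathbf{x}^{\mathbf{w}},\quad x_4^{a_4}-\mathbf{x}^{\mathbf{z}}$$ generate $\mathcal{C}_A$, where each of $\mathbf{x}^{\mathbf{u}},\mathbf{x}^{\mathbf{v}},\mathbf{x}^{\mathbf{w}},\mathbf{x}^{\mathbf{z}}$ has a support with at least two elements. Let $\mathcal{I}$ be the set of all binomials $x_{i_1}^{u_{i_1}}x_{i_2}^{u_{i_2}}-x_{i_3}^{u_{i_3}}x_{i_4}^{u_{i_4}}\in I(C)$ with $\{i_1,i_2,i_3,i_4\}=\{1,2,3,4\}$, $0<u_{i_j}<a_{i_j}$ for $j=1,2$, $u_{i_3}>0$, $u_{i_4}>0$, and $x_{i_3}^{u_{i_3}}x_{i_4}^{u_{i_4}}$ indispensable (i.e. every system of binomial generators of $I(C)$ contains a binomial in which this monomial occurs). Say that a monomial $M=x_2^{d_2}x_3^{d_3}x_4^{d_4}$ satisfies $(\ast)$ if either $d_2n_2+d_3n_3+d_4n_4\notin n_1+\mathcal{S}$, or there is a monomial $N$ with $1\in\operatorname{supp}(N)$, $M-N\in I(C)$ and $\deg(M)\le\deg(N)$. Suppose that $1\notin\operatorname{supp}(\mathbf{x}^{\mathbf{v}})$.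 Then in each of the following cases $C$ has Cohen–Macaulay tangent cone at the origin, i.e. the ring $K[x_1,\dots,x_4]/I(C)_*$ is Cohen–Macaulay, where $I(C)_*$ is the ideal generated by the homogeneous components of least degree of the nonzero elements of $I(C)$. (i) $1\in\operatorname{supp}(\mathbf{x}^{\mathbf{w}})$, $1\in\operatorname{supp}(\mathbf{x}^{\mathbf{z}})$ and: (1) $a_3\le\deg(\mathbf{x}^{\mathbf{w}})$; (2) for every binomial $M-N\in\mathcal{I}$ with $1\in\operatorname{supp}(M)$ we have $\deg(N)\le\deg(M)$; (3) every monomial $x_2^{d_2}x_3^{d_3}x_4^{d_4}$ with $d_2\ge a_2$, $d_3<a_3$ and $d_4<a_4$ satisfies $(\ast)$. (ii) $1\in\operatorname{supp}(\mathbf{x}^{\mathbf{w}})$, $1\notin\operatorname{supp}(\mathbf{x}^{\mathbf{z}})$ and: (1) $a_3\le\deg(\mathbf{x}^{\mathbf{w}})$; (2) every monomial $x_2^{d_2}x_3^{d_3}x_4^{d_4}$ with $d_3<a_3$ satisfies $(\ast)$. (iii) $1\notin\operatorname{supp}(\mathbf{x}^{\mathbf{w}})$, $1\in\operatorname{supp}(\mathbf{x}^{\mathbf{z}})$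 and every monomial $x_2^{d_2}x_3^{d_3}x_4^{d_4}$ with $d_4<a_4$ satisfies $(\ast)$. -/

import Mathlib

open MvPolynomial

noncomputable section

/-- A local ring is Cohen–Macaulay if its maximal ideal contains a regular sequence whose length
is the Krull dimension (so that depth and dimension agree). -/
def IsCohenMacaulayLocal (R : Type*) [CommRing R] [IsLocalRing R] : Prop :=
  IsNoetherianRing R ∧
    ∃ rs : List R, (∀ r ∈ rs, r ∈ IsLocalRing.maximalIdeal R) ∧
      RingTheory.Sequence.IsRegular R rs ∧
      ((rs.length : ℕ) : WithBot ℕ∞) = ringKrullDim R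

/-- A Noetherian ring is Cohen–Macaulay if its localization at every maximal ideal is. -/
def IsCohenMacaulayRing (R : Type*) [CommRing R] : Prop :=
  IsNoetherianRing R ∧
    ∀ (p : Ideal R) [p.IsMaximal], IsCohenMacaulayLocal (Localization.AtPrime p)

/-- `f_*`: the nonzero homogeneous component of least degree of `f` (and `0` for `f = 0`). -/
def lowestForm {K : Type*} [Field K] (f : MvPolynomial (Fin 4) K) : MvPolynomial (Fin 4) K :=
  homogeneousComponent (sInf {d : ℕ | homogeneousComponent d f ≠ 0}) f

/-- `I_*`: the ideal generated by the forms `f_*` for `f ∈ I`. -/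
def lowestFormIdeal {K : Type*} [Field K] (I : Ideal (MvPolynomial (Fin 4) K)) :
    Ideal (MvPolynomial (Fin 4) K) :=
  Ideal.span {g | ∃ f ∈ I, g = lowestForm f}

/-- The toric ideal `I(C)`: the kernel of `K[x₁, …, x₄] → K[t]`, `xᵢ ↦ t ^ nᵢ`. The variables
`x₁, …, x₄` are `X 0, …, X 3`. -/
def toricIdeal (K : Type*) [Field K] (n : Fin 4 → ℕ) : Ideal (MvPolynomial (Fin 4) K) :=
  RingHom.ker (aeval (fun i : Fin 4 => (Polynomial.X : Polynomial K) ^ n i) :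
    MvPolynomial (Fin 4) K →ₐ[K] Polynomial K)

/-- The coordinate ring `K[x₁, …, x₄] / I(C)_*` of the tangent cone at the origin of the monomial
curve `C` with parametrization `xᵢ = t ^ nᵢ` is Cohen–Macaulay. -/
def HasCohenMacaulayTangentCone (K : Type*) [Field K] (n : Fin 4 → ℕ) : Prop :=
  IsCohenMacaulayRing (MvPolynomial (Fin 4) K ⧸ lowestFormIdeal (toricIdeal K n))

/-- The numerical semigroup `𝒮` generated by `n₁, …, n₄`. -/
def numSemigroup (n : Fin 4 → ℕ) : AddSubmonoid ℕ :=
  AddSubmonoid.closure (Set.range n)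

/-- The monomial `x ^ u`. -/
abbrev mono (K : Type*) [Field K] (u : Fin 4 →₀ ℕ) : MvPolynomial (Fin 4) K :=
  monomial u 1

/-- The support of the monomial `x ^ u`: the indices of the variables that divide it. -/
def monoSupp (u : Fin 4 →₀ ℕ) : Finset (Fin 4) :=
  u.support

/-- The total degree of the monomial `x ^ u`. -/
def monoDeg (u : Fin 4 →₀ ℕ) : ℕ :=
  ∑ i, u i

/-- `a` is the least positive integer such that `a * nᵢ` is an `ℕ`-linear combination of the `nⱼ`
with `j ≠ i`. -/
def IsCriticalExponent (n : Fin 4 → ℕ) (i : Fin 4) (a : ℕ) : Prop :=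
  IsLeast {b : ℕ | 0 < b ∧ b * n i ∈ AddSubmonoid.closure (n '' {j | j ≠ i})} a

/-- `f` is a critical binomial of `I(C)` with respect to `xᵢ`. -/
def IsCriticalBinomial (K : Type*) [Field K] (n : Fin 4 → ℕ) (i : Fin 4)
    (f : MvPolynomial (Fin 4) K) : Prop :=
  ∃ (a : ℕ) (u : Fin 4 →₀ ℕ), IsCriticalExponent n i a ∧ u i = 0 ∧
    f = X i ^ a - mono K u ∧ f ∈ toricIdeal K n

/-- The critical ideal, generated by all the critical binomials of `I(C)`. -/
def criticalIdeal (K : Type*) [Field K] (n : Fin 4 → ℕ) : Ideal (MvPolynomial (Fin 4) K) :=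
  Ideal.span {f | ∃ i, IsCriticalBinomial K n i f}

/-- The first case of the classification: the numbers `aᵢ nᵢ` are pairwise different, and the
critical binomials `xᵢ ^ aᵢ - x ^ uᵢ`, `i = 1, …, 4`, where every `x ^ uᵢ` has at least two
variables in its support, generate the critical ideal. -/
structure IsCaseOne (K : Type*) [Field K] (n a : Fin 4 → ℕ) (u : Fin 4 → (Fin 4 →₀ ℕ)) :
    Prop where
  exponent : ∀ i, IsCriticalExponent n i (a i)
  critical : ∀ i, IsCriticalBinomial K n i (X i ^ a i - mono K (u i))
  distinct : ∀ i j, i ≠ j → a i * n i ≠ a j * n j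
  two_le_card_supp : ∀ i, 2 ≤ (monoSupp (u i)).card
  span_eq : Ideal.span (Set.range fun i => X i ^ a i - mono K (u i)) = criticalIdeal K n

/-- A difference of two monomials. -/
def IsBinomial {K : Type*} [Field K] (f : MvPolynomial (Fin 4) K) : Prop :=
  ∃ u v : Fin 4 →₀ ℕ, f = mono K u - mono K v

/-- The monomial `x ^ u` is indispensable for the ideal `I`: every system of binomial generators
of `I` contains a binomial one of whose terms is, up to sign, `x ^ u`. -/
def IsIndispensableMonomial {K : Type*} [Field K] (I : Ideal (MvPolynomial (Fin 4) K))
    (u : Fin 4 →₀ ℕ) : Prop :=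
  ∀ B : Set (MvPolynomial (Fin 4) K), (∀ f ∈ B, IsBinomial f) → Ideal.span B = I →
    ∃ f ∈ B, u ∈ f.support

/-- The pairs `(p, q)` such that the binomial `x ^ p - x ^ q` belongs to the set `ℐ`:
`x ^ p` is a product of powers of two of the variables, with positive exponents less than the
corresponding critical exponents, `x ^ q` is a product of powers of the other two variables, with
positive exponents, `x ^ q` is indispensable, and `x ^ p - x ^ q ∈ I(C)`. -/
def IsTwoTwoBinomial (K : Type*) [Field K] (n a : Fin 4 → ℕ) (p q : Fin 4 →₀ ℕ) : Prop :=
  mono K p - mono K q ∈ toricIdeal K n ∧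
    (∃ σ : Equiv.Perm (Fin 4),
      (0 < p (σ 0) ∧ p (σ 0) < a (σ 0)) ∧ (0 < p (σ 1) ∧ p (σ 1) < a (σ 1)) ∧
      p (σ 2) = 0 ∧ p (σ 3) = 0 ∧
      q (σ 0) = 0 ∧ q (σ 1) = 0 ∧ 0 < q (σ 2) ∧ 0 < q (σ 3)) ∧
    IsIndispensableMonomial (toricIdeal K n) q

/-- The monomial `x₂ ^ d₂ * x₃ ^ d₃ * x₄ ^ d₄`. -/
def expo (d₂ d₃ d₄ : ℕ) : Fin 4 →₀ ℕ :=
  Finsupp.single 1 d₂ + Finsupp.single 2 d₃ + Finsupp.single 3 d₄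

/-- If `d₂ n₂ + d₃ n₃ + d₄ n₄ ∈ n₁ + 𝒮`, then for `M = x₂ ^ d₂ * x₃ ^ d₃ * x₄ ^ d₄` there is a
monomial `N` divisible by `x₁` with `M - N ∈ I(C)` and `deg M ≤ deg N`. -/
def SatisfiesDegreeCondition (K : Type*) [Field K] (n : Fin 4 → ℕ) (d₂ d₃ d₄ : ℕ) : Prop :=
  (∃ s ∈ numSemigroup n, d₂ * n 1 + d₃ * n 2 + d₄ * n 3 = n 0 + s) →
    ∃ N : Fin 4 →₀ ℕ, 0 ∈ monoSupp N ∧ mono K (expo d₂ d₃ d₄) - mono K N ∈ toricIdeal K n ∧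
      monoDeg (expo d₂ d₃ d₄) ≤ monoDeg N

end

/-! The tangent cone is Cohen–Macaulay as soon as every monomial M whose weight is attained by a
multiple of x₁ shares that weight with a multiple of x₁ of degree at least deg M
(`HasHighDegreeRep`). Indeed `K[x]/I_*` embeds K-linearly in `K[t]` by sending a monomial of largest
degree in its weight to t^weight and every other monomial to 0 (`mem_lowestFormIdeal_iff`). Under
the degree condition x₁ acts as multiplication by t^n₁, so the quotient is torsion-free over
`K[x₁]`. It is also integral over it, because x_i^n₁ lies in `I_*` for i ≠ 1, and
`isCohenMacaulayRing_of_isIntegral` applies.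

The degree condition is combinatorial. A factor x₃^a₃ or x₄^a₄ is exchanged for the tail of its
critical binomial when that tail contains x₁, and most other monomials satisfy (∗) by assumption.
What remains is case (i) with all exponents below the critical ones
(`IsCaseOne.hasHighDegreeRep_of_lt`). There a minimal divisor m of M with non-unique weight is an
indispensable monomial, disjoint from the rest of its fibre, and its support decides which
hypothesis applies. -/

/-! ### Weights, degrees and critical exponents. -/

/-- The weight of the exponent vector `u`: the exponent of `t` in the image of `x ^ u`. -/
def weightOf (n : Fin 4 → ℕ) (u : Fin 4 →₀ ℕ) : ℕ := ∑ i, u i * n i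

lemma weightOf_add (n : Fin 4 → ℕ) (u v : Fin 4 →₀ ℕ) :
    weightOf n (u + v) = weightOf n u + weightOf n v := by
  simp [weightOf, add_mul, Finset.sum_add_distrib]

lemma weightOf_single (n : Fin 4 → ℕ) (i : Fin 4) (k : ℕ) :
    weightOf n (Finsupp.single i k) = k * n i := by
  simp [weightOf, Finsupp.single_apply, ite_mul]

lemma monoDeg_add (u v : Fin 4 →₀ ℕ) : monoDeg (u + v) = monoDeg u + monoDeg v := by
  simp [monoDeg, Finset.sum_add_distrib]

lemma monoDeg_single (i : Fin 4) (k : ℕ) : monoDeg (Finsupp.single i k) = k := by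
  simp [monoDeg, Finsupp.single_apply]

lemma aeval_monomial_weightOf {K : Type*} [Field K] (n : Fin 4 → ℕ) (u : Fin 4 →₀ ℕ) (c : K) :
    aeval (fun i : Fin 4 => (Polynomial.X : Polynomial K) ^ n i) (monomial u c) =
      Polynomial.monomial (weightOf n u) c := by
  rw [aeval_monomial, Finsupp.prod_fintype _ _ (by simp), ← Polynomial.C_mul_X_pow_eq_monomial]
  simp [weightOf, ← pow_mul, Finset.prod_pow_eq_pow_sum, mul_comm]

lemma mono_sub_mem_toricIdeal {K : Type*} [Field K] {n : Fin 4 → ℕ} {p q : Fin 4 →₀ ℕ} :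
    mono K p - mono K q ∈ toricIdeal K n ↔ weightOf n p = weightOf n q := by
  change aeval (fun i : Fin 4 => (Polynomial.X : Polynomial K) ^ n i) (mono K p - mono K q) = 0 ↔ _
  rw [map_sub, sub_eq_zero, aeval_monomial_weightOf, aeval_monomial_weightOf]
  refine ⟨fun h => ?_, fun h => by rw [h]⟩
  simpa [Polynomial.natDegree_monomial_eq] using congrArg Polynomial.natDegree h

lemma weightOf_mem_numSemigroup (n : Fin 4 → ℕ) (u : Fin 4 →₀ ℕ) :
    weightOf n u ∈ numSemigroup n :=
  sum_mem fun i _ => by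
    simpa [numSemigroup] using
      nsmul_mem (AddSubmonoid.subset_closure (Set.mem_range_self (f := n) i)) (u i)

lemma IsCriticalExponent.le {n : Fin 4 → ℕ} {i : Fin 4} {a k : ℕ} (h : IsCriticalExponent n i a)
    (hk : 0 < k) {N : Fin 4 →₀ ℕ} (hN : N i = 0) (hw : weightOf n N = k * n i) : a ≤ k := by
  refine h.2 ⟨hk, ?_⟩
  rw [← hw]
  refine sum_mem fun j _ => ?_
  by_cases hj : j = i
  · subst hj
    simp [hN]
  · simpa using nsmul_mem (AddSubmonoid.subset_closure
      (Set.mem_image_of_mem n (show j ∈ {j | j ≠ i} from hj))) (N j)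

/-- Trading variables of weight at least `c` for variables of weight at most `c` cannot lower the
degree. -/
lemma monoDeg_le_of_weightOf_eq {n : Fin 4 → ℕ} {p q : Fin 4 →₀ ℕ} (c : ℕ) (hc : 0 < c)
    (hw : weightOf n p = weightOf n q) (hp : ∀ i, p i ≠ 0 → c ≤ n i)
    (hq : ∀ i, q i ≠ 0 → n i ≤ c) : monoDeg p ≤ monoDeg q := by
  refine Nat.le_of_mul_le_mul_right ?_ hc
  calc monoDeg p * c ≤ weightOf n p := by
        rw [monoDeg, weightOf, Finset.sum_mul]
        refine Finset.sum_le_sum fun i _ => ?_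
        by_cases h : p i = 0
        · simp [h]
        · exact Nat.mul_le_mul_left _ (hp i h)
    _ = weightOf n q := hw
    _ ≤ monoDeg q * c := by
        rw [monoDeg, weightOf, Finset.sum_mul]
        refine Finset.sum_le_sum fun i _ => ?_
        by_cases h : q i = 0
        · simp [h]
        · exact Nat.mul_le_mul_left _ (hq i h)

lemma IsCaseOne.tail_self_eq_zero {K : Type*} [Field K] {n a : Fin 4 → ℕ}
    {u : Fin 4 → Fin 4 →₀ ℕ} (h : IsCaseOne K n a u) (i : Fin 4) : u i i = 0 := by
  obtain ⟨b, v, hb, hv, he, -⟩ := h.critical i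
  obtain rfl : b = a i := hb.unique (h.exponent i)
  rw [sub_right_inj] at he
  rwa [monomial_left_injective one_ne_zero he]

lemma IsCaseOne.weightOf_tail {K : Type*} [Field K] {n a : Fin 4 → ℕ}
    {u : Fin 4 → Fin 4 →₀ ℕ} (h : IsCaseOne K n a u) (i : Fin 4) :
    weightOf n (u i) = a i * n i := by
  obtain ⟨b, v, hb, hv, he, hI⟩ := h.critical i
  rw [X_pow_eq_monomial, mono_sub_mem_toricIdeal, weightOf_single] at hI
  exact hI.symm

/-! ### Representatives divisible by x₁ of no smaller degree. -/

/-- Some monomial divisible by `x₁` has the weight of `x ^ M` and at least its degree. -/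
def HasHighDegreeRep (n : Fin 4 → ℕ) (M : Fin 4 →₀ ℕ) : Prop :=
  ∃ N : Fin 4 →₀ ℕ, 0 < N 0 ∧ weightOf n N = weightOf n M ∧ monoDeg M ≤ monoDeg N

lemma HasHighDegreeRep.of_weightOf_eq {n : Fin 4 → ℕ} {M N : Fin 4 →₀ ℕ}
    (h : HasHighDegreeRep n N) (hw : weightOf n N = weightOf n M) (hd : monoDeg M ≤ monoDeg N) :
    HasHighDegreeRep n M :=
  let ⟨P, h0, hP, hPd⟩ := h
  ⟨P, h0, hP.trans hw, hd.trans hPd⟩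

lemma HasHighDegreeRep.mono {n : Fin 4 → ℕ} {m M : Fin 4 →₀ ℕ}
    (h : HasHighDegreeRep n m) (hle : m ≤ M) : HasHighDegreeRep n M := by
  obtain ⟨P, h0, hP, hPd⟩ := h
  obtain ⟨r, rfl⟩ := le_iff_exists_add.1 hle
  refine ⟨P + r, by simp; omega, by rw [weightOf_add, weightOf_add, hP], ?_⟩
  rw [monoDeg_add, monoDeg_add]
  omega

lemma hasHighDegreeRep_of_single_le {n : Fin 4 → ℕ} {M t : Fin 4 →₀ ℕ} {i : Fin 4} {b : ℕ}
    (hw : weightOf n t = b * n i) (ht : 0 < t 0) (hb : b ≤ monoDeg t) (hM : b ≤ M i) :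
    HasHighDegreeRep n M := by
  refine HasHighDegreeRep.mono (m := Finsupp.single i b)
    ⟨t, ht, by rw [hw, weightOf_single], by rwa [monoDeg_single]⟩ ?_
  simpa using hM

lemma SatisfiesDegreeCondition.hasHighDegreeRep {K : Type*} [Field K] {n : Fin 4 → ℕ}
    {M N : Fin 4 →₀ ℕ} (h : SatisfiesDegreeCondition K n (M 1) (M 2) (M 3)) (hM : M 0 = 0)
    (hN : 0 < N 0) (hw : weightOf n N = weightOf n M) : HasHighDegreeRep n M := by
  have he : expo (M 1) (M 2) (M 3) = M := by
    ext i
    fin_cases i <;> simp [expo, hM]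
  obtain ⟨r, rfl⟩ : ∃ r, N = Finsupp.single 0 1 + r := le_iff_exists_add.1 
    (by simpa using Nat.succ_le_of_lt hN)
  obtain ⟨P, h0, hP, hd⟩ := h ⟨weightOf n r, weightOf_mem_numSemigroup n r, by
    rw [weightOf_add, weightOf_single, one_mul] at hw
    rw [hw]
    simp [weightOf, Fin.sum_univ_four, hM]⟩
  rw [he] at hP hd
  exact ⟨P, Nat.pos_of_ne_zero (by simpa [monoSupp] using h0),
    (mono_sub_mem_toricIdeal.1 hP).symm, hd⟩

/-! ### Minimal monomials of non-unique weight. -/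

/-- The fibre of the weight through `u` has another element. -/
def HasNonuniqueWeight (n : Fin 4 → ℕ) (u : Fin 4 →₀ ℕ) : Prop :=
  ∃ v, v ≠ u ∧ weightOf n v = weightOf n u

/-- Cancelling a common variable would leave a smaller monomial of non-unique weight. -/
lemma disjoint_of_minimal_hasNonuniqueWeight {n : Fin 4 → ℕ} {m : Fin 4 →₀ ℕ}
    (hm : Minimal (HasNonuniqueWeight n) m) {N : Fin 4 →₀ ℕ} (hN : N ≠ m)
    (hw : weightOf n N = weightOf n m) {i : Fin 4} (hi : m i ≠ 0) : N i = 0 := by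
  by_contra hNi
  obtain ⟨r, rfl⟩ : ∃ r, m = Finsupp.single i 1 + r :=
    le_iff_exists_add.1 (by simpa using Nat.one_le_iff_ne_zero.2 hi)
  obtain ⟨s, rfl⟩ : ∃ s, N = Finsupp.single i 1 + s :=
    le_iff_exists_add.1 (by simpa using Nat.one_le_iff_ne_zero.2 hNi)
  rw [weightOf_add, weightOf_add, Nat.add_left_cancel_iff] at hw
  have h := hm.2 (y := r) ⟨s, fun h => hN (by rw [h]), hw⟩ le_add_self i
  simp at h

/-- A term of a nonzero binomial in the ideal has non-unique weight, so by minimality it divides x^m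
only if it equals x^m. If x^m occurred in no generator, the ideal would lie in the monomial ideal
spanned by the non-divisors of x^m, yet it contains x^m - x^N. -/
lemma isIndispensableMonomial_of_minimal {K : Type*} [Field K] {n : Fin 4 → ℕ} {m : Fin 4 →₀ ℕ}
    (hm : Minimal (HasNonuniqueWeight n) m) : IsIndispensableMonomial (toricIdeal K n) m := by
  intro B hB hspan
  obtain ⟨N, hN, hw⟩ := hm.1
  by_contra! hcon
  have hle : toricIdeal K n ≤ Ideal.span ((fun s => monomial s (1 : K)) '' {s | ¬ s ≤ m}) := by
    rw [← hspan, Ideal.span_le]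
    intro f hf
    rw [SetLike.mem_coe, mem_ideal_span_monomial_image]
    intro s hs
    refine ⟨s, fun hsm => ?_, le_rfl⟩
    have hsm' : s ≠ m := fun h => hcon f hf (h ▸ hs)
    obtain ⟨p, q, rfl⟩ := hB f hf
    have hI : mono K p - mono K q ∈ toricIdeal K n := hspan ▸ Ideal.subset_span hf
    rw [mono_sub_mem_toricIdeal] at hI
    have hpq : p ≠ q := by
      rintro rfl
      simp at hs
    have hs' : s = p ∨ s = q := by
      by_contra! h
      simp [coeff_monomial, h.1.symm, h.2.symm] at hs
    refine hsm' (hm.eq_of_le ?_ hsm)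
    rcases hs' with rfl | rfl
    · exact ⟨q, hpq.symm, hI.symm⟩
    · exact ⟨p, hpq, hI⟩
  have hmem := hle (mono_sub_mem_toricIdeal (K := K).2 hw.symm)
  rw [mem_ideal_span_monomial_image] at hmem
  obtain ⟨s, hs, hsm⟩ := hmem m (by simp [coeff_monomial, hN])
  exact hs hsm

section MinimalFibre

variable {n : Fin 4 → ℕ}

lemma ne_zero_of_weightOf_eq (hpos : ∀ i, 0 < n i) {u v : Fin 4 →₀ ℕ} (hu : u ≠ 0)
    (hw : weightOf n v = weightOf n u) : v ≠ 0 := by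
  rintro rfl
  obtain ⟨i, hi⟩ := Finsupp.ne_iff.1 hu
  have h : weightOf n u = 0 := by
    rw [← hw]
    simp [weightOf]
  have := (Finset.sum_eq_zero_iff.1 h) i (Finset.mem_univ i)
  rcases mul_eq_zero.1 this with h1 | h1
  · exact hi h1
  · exact (hpos i).ne' h1

/-- An element `N` of the fibre of a minimal exponent vector `m` with non-unique weight is not
divisible by a power of `xᵢ` that can be replaced by a monomial meeting `m`, unless the replacement
gives `m`. -/
lemma lt_of_minimal_hasNonuniqueWeight {m N t : Fin 4 →₀ ℕ} {i j : Fin 4} {b : ℕ}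
    (hm : Minimal (HasNonuniqueWeight n) m) (hw : weightOf n N = weightOf n m)
    (ht : weightOf n t = b * n i) (hmj : m j ≠ 0) (htj : t j ≠ 0)
    (hne : ∃ l, m l = 0 ∧ (t l ≠ 0 ∨ (l ≠ i ∧ N l ≠ 0))) : N i < b := by
  by_contra! hb
  obtain ⟨r, rfl⟩ : ∃ r, N = Finsupp.single i b + r := le_iff_exists_add.1 (by simpa using hb)
  obtain ⟨l, hml, hl⟩ := hne
  have h := disjoint_of_minimal_hasNonuniqueWeight hm (N := t + r) ?_ ?_ hmj
  · simp [htj] at h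
  -- The index `l` separates the two: `m` vanishes there and `t + r` does not.
  · rintro rfl
    rcases hl with hl | ⟨hli, hl⟩
    · exact hl (by simpa using (Nat.add_eq_zero_iff.1 hml).1)
    · simp only [Finsupp.add_apply, Finsupp.single_apply, if_neg hli.symm, zero_add] at hml hl
      omega
  · rw [weightOf_add, ht, ← hw, weightOf_add, weightOf_single]

lemma exists_ne_of_two_le_card_supp {t : Fin 4 →₀ ℕ} (h : 2 ≤ (monoSupp t).card) (i : Fin 4) :
    ∃ j, j ≠ i ∧ t j ≠ 0 := by
  obtain ⟨j, hj, hji⟩ := Finset.exists_mem_ne (Nat.lt_of_succ_le h) i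
  exact ⟨j, hji, by simpa [monoSupp] using hj⟩

end MinimalFibre

/-! ### Fibres of minimal monomials under the critical binomials. -/

section CaseOne

variable {K : Type*} [Field K] {n a : Fin 4 → ℕ} {U : Fin 4 → Fin 4 →₀ ℕ}

/-- The tail of the i-th critical binomial has two variables different from x_i, so one of them is
x_b or x_d and the tail meets `m`. -/
lemma IsCaseOne.lt_of_minimal (h : IsCaseOne K n a U) {m N : Fin 4 →₀ ℕ} {i b d : Fin 4}
    (hm : Minimal (HasNonuniqueWeight n) m) (hw : weightOf n N = weightOf n m)
    (hb : m b ≠ 0) (hd : m d ≠ 0) {c : Fin 4} (hcov : ∀ j, j = c ∨ j = i ∨ j = b ∨ j = d)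
    (hne : ∃ l, m l = 0 ∧ (U i l ≠ 0 ∨ (l ≠ i ∧ N l ≠ 0))) : N i < a i := by
  obtain ⟨j, hj⟩ : ∃ j, m j ≠ 0 ∧ U i j ≠ 0 := by
    obtain ⟨j, hjc, hj⟩ := exists_ne_of_two_le_card_supp (h.two_le_card_supp i) c
    rcases hcov j with rfl | rfl | rfl | rfl
    · exact absurd rfl hjc
    · exact absurd (h.tail_self_eq_zero j) hj
    · exact ⟨j, hb, hj⟩
    · exact ⟨j, hd, hj⟩
  exact lt_of_minimal_hasNonuniqueWeight hm hw (h.weightOf_tail i) hj.1 hj.2 hne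

/-- A minimal monomial with non-unique weight in two variables, where the power of the third one is
replaceable by a multiple of `x₁`, is the indispensable term of a binomial in `ℐ`. -/
lemma IsCaseOne.hasHighDegreeRep_of_two_two (h : IsCaseOne K n a U) (hpos : ∀ i, 0 < n i)
    (htwo : ∀ p q : Fin 4 →₀ ℕ, IsTwoTwoBinomial K n a p q → 0 ∈ monoSupp p →
        monoDeg q ≤ monoDeg p)
    {m : Fin 4 →₀ ℕ} (hm : Minimal (HasNonuniqueWeight n) m) (hn : ∀ i, n 0 ≤ n i)
    (σ : Equiv.Perm (Fin 4)) (h0 : σ 0 = 0) (hU : U (σ 1) 0 ≠ 0) (hm0 : m 0 = 0)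
    (hm1 : m (σ 1) = 0) (hm2 : m (σ 2) ≠ 0) (hm3 : m (σ 3) ≠ 0) : HasHighDegreeRep n m := by
  obtain ⟨N, hN, hw⟩ := hm.1
  have hN2 : N (σ 2) = 0 := disjoint_of_minimal_hasNonuniqueWeight hm hN hw hm2
  have hN3 : N (σ 3) = 0 := disjoint_of_minimal_hasNonuniqueWeight hm hN hw hm3
  have hcov (j : Fin 4) : j = 0 ∨ j = σ 1 ∨ j = σ 2 ∨ j = σ 3 := by
    obtain ⟨k, rfl⟩ := σ.surjective j
    fin_cases k <;> simp [h0]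
  have hlt1 : N (σ 1) < a (σ 1) :=
    h.lt_of_minimal hm hw hm2 hm3 hcov ⟨0, hm0, Or.inl hU⟩
  -- Otherwise x^N is a power of x_{σ 1} with exponent below the critical one.
  have hN0 : N 0 ≠ 0 := by
    intro hN0
    have hw1 : weightOf n N = N (σ 1) * n (σ 1) := by
      rw [weightOf, Finset.sum_eq_single (σ 1) _ (by simp)]
      intro j _ hj
      rcases hcov j with rfl | rfl | rfl | rfl
      · rw [hN0, zero_mul]
      · exact absurd rfl hj
      · rw [hN2, zero_mul]
      · rw [hN3, zero_mul]
    refine hlt1.not_ge ((h.exponent (σ 1)).le (Nat.pos_of_ne_zero fun hz => ?_) hm1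
      (hw.symm.trans hw1))
    refine ne_zero_of_weightOf_eq hpos (u := m) (v := N) (fun hm' => hm2 (by simp [hm'])) hw ?_
    ext j
    rcases hcov j with rfl | rfl | rfl | rfl <;> simpa
  -- A pure power of x₁ has enough degree because n₁ is smallest; otherwise x^N - x^m lies in `ℐ`.
  by_cases hN1 : N (σ 1) = 0
  · refine ⟨N, Nat.pos_of_ne_zero hN0, hw,
      monoDeg_le_of_weightOf_eq (n 0) (hpos 0) hw.symm (fun i _ => hn i) fun i hi => ?_⟩
    rcases hcov i with rfl | rfl | rfl | rfl
    · exact le_rfl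
    all_goals contradiction
  · have hlt0 : N 0 < a 0 :=
      h.lt_of_minimal hm hw hm2 hm3 (c := σ 1) (fun j => by have := hcov j; tauto)
        ⟨σ 1, hm1, Or.inr ⟨fun h1 => by simpa using σ.injective (h1.trans h0.symm), hN1⟩⟩
    refine ⟨N, Nat.pos_of_ne_zero hN0, hw, htwo N m ⟨mono_sub_mem_toricIdeal.2 hw, ⟨σ, ?_⟩,
      isIndispensableMonomial_of_minimal hm⟩ (by simpa [monoSupp] using hN0)⟩
    rw [h0]
    exact ⟨⟨Nat.pos_of_ne_zero hN0, hlt0⟩, ⟨Nat.pos_of_ne_zero hN1, hlt1⟩, hN2, hN3, hm0, hm1,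
      Nat.pos_of_ne_zero hm2, Nat.pos_of_ne_zero hm3⟩

/-- If `m` were a pure power of x_i, another element of its fibre would avoid x_i, making the
exponent at least a_i. -/
lemma IsCaseOne.exists_ne_of_minimal (h : IsCaseOne K n a U) (hpos : ∀ i, 0 < n i)
    {m : Fin 4 →₀ ℕ}
    (hm : Minimal (HasNonuniqueWeight n) m) (i : Fin 4) (hi : m i < a i) :
    ∃ j, j ≠ i ∧ m j ≠ 0 := by
  by_contra! hcon
  obtain ⟨N, hN, hw⟩ := hm.1
  have hmi : m i ≠ 0 := fun hmi => by
    have hm0 : m = 0 := by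
      ext j
      by_cases hj : j = i
      · rw [hj, hmi]; rfl
      · exact hcon j hj
    exact ne_zero_of_weightOf_eq hpos (hm0 ▸ hN) hw.symm hm0
  have hwm : weightOf n m = m i * n i := by
    rw [weightOf, Finset.sum_eq_single i _ (by simp)]
    intro j _ hj
    rw [hcon j hj, zero_mul]
  exact hi.not_ge ((h.exponent i).le (Nat.pos_of_ne_zero hmi)
    (disjoint_of_minimal_hasNonuniqueWeight hm hN hw hmi) (hw.trans hwm))

lemma IsCaseOne.hasHighDegreeRep_of_lt (h : IsCaseOne K n a U) (hpos : ∀ i, 0 < n i)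
    (hmono : StrictMono n) (hw0 : U 2 0 ≠ 0) (hz0 : U 3 0 ≠ 0)
    (htwo : ∀ p q : Fin 4 →₀ ℕ, IsTwoTwoBinomial K n a p q → 0 ∈ monoSupp p →
        monoDeg q ≤ monoDeg p)
    (hdeg : ∀ d₂ d₃ d₄ : ℕ, a 1 ≤ d₂ → d₃ < a 2 → d₄ < a 3 →
        SatisfiesDegreeCondition K n d₂ d₃ d₄)
    {M N : Fin 4 →₀ ℕ} (hM : M 0 = 0) (h1 : M 1 < a 1) (h2 : M 2 < a 2) (h3 : M 3 < a 3)
    (hN0 : 0 < N 0) (hNM : weightOf n N = weightOf n M) : HasHighDegreeRep n M := by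
  have hn0 (i) : n 0 ≤ n i := hmono.monotone (Fin.zero_le i)
  obtain ⟨m, hmM, hm⟩ := exists_minimal_le_of_wellFoundedLT (HasNonuniqueWeight n) M
    ⟨N, fun hcon => by simp [hcon, hM] at hN0, hNM⟩
  have hm0 : m 0 = 0 := Nat.le_zero.1 ((hmM 0).trans hM.le)
  have hs1 := h.exists_ne_of_minimal hpos hm 1 ((hmM 1).trans_lt h1)
  have hs2 := h.exists_ne_of_minimal hpos hm 2 ((hmM 2).trans_lt h2)
  have hs3 := h.exists_ne_of_minimal hpos hm 3 ((hmM 3).trans_lt h3)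
  by_cases hm1 : m 1 = 0
  · have hm2 : m 2 ≠ 0 := by
      intro hm2
      obtain ⟨i, hi, hmi⟩ := hs3
      fin_cases i <;> contradiction
    have hm3 : m 3 ≠ 0 := by
      intro hm3
      obtain ⟨i, hi, hmi⟩ := hs2
      fin_cases i <;> contradiction
    obtain ⟨P, hP, hPw⟩ := hm.1
    have hP2 := disjoint_of_minimal_hasNonuniqueWeight hm hP hPw hm2
    have hP3 := disjoint_of_minimal_hasNonuniqueWeight hm hP hPw hm3
    -- `m` involves only x₃, x₄ and `P` only x₁, x₂, so n₂ separates their weights.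
    have hPd : monoDeg m ≤ monoDeg P := by
      refine monoDeg_le_of_weightOf_eq (n 1) (hpos 1) hPw.symm (fun i hi => ?_) fun i hi => ?_
      · exact hmono.monotone (Fin.one_le_of_ne_zero fun h => hi (h ▸ hm0))
      · refine hmono.monotone ?_
        fin_cases i
        · decide
        · decide
        · exact absurd hP2 hi
        · exact absurd hP3 hi
    by_cases hP0 : P 0 = 0
    · have hP1 : a 1 ≤ P 1 := by
        refine (h.exponent 1).le (Nat.pos_of_ne_zero fun hz => ?_) hm1 (N := m) ?_
        · refine ne_zero_of_weightOf_eq hpos (u := m) (v := P) (fun h => hm2 (by simp [h])) hPw ?_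
          ext i
          fin_cases i <;> assumption
        · rw [← hPw]
          simp [weightOf, Fin.sum_univ_four, hP0, hP2, hP3]
      -- Here `P` is a power of x₂ with exponent at least a₂. Exchanging `m` for `P` in `M` keeps
      -- the exponents of x₃ and x₄ small, so the degree condition applies to `P + r`.
      obtain ⟨r, rfl⟩ := le_iff_exists_add.1 hmM
      have hw : weightOf n (P + r) = weightOf n (m + r) := by
        rw [weightOf_add, weightOf_add, hPw]
      refine HasHighDegreeRep.of_weightOf_eq (N := P + r) ?_ hw ?_
      · simp only [Finsupp.add_apply] at hM h2 h3
        refine SatisfiesDegreeCondition.hasHighDegreeRep (K := K) (hdeg _ _ _ ?_ ?_ ?_) ?_ hN0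
          (hNM.trans hw.symm)
        all_goals
          simp only [Finsupp.add_apply]
          omega
      · rw [monoDeg_add, monoDeg_add]
        omega
    · exact HasHighDegreeRep.mono ⟨P, Nat.pos_of_ne_zero hP0, hPw, hPd⟩ hmM
  · refine HasHighDegreeRep.mono ?_ hmM
    by_cases hm2 : m 2 = 0
    · have hm3 : m 3 ≠ 0 := by
        intro hm3
        obtain ⟨i, hi, hmi⟩ := hs1
        fin_cases i <;> contradiction
      exact h.hasHighDegreeRep_of_two_two hpos htwo hm hn0 (Equiv.swap 1 2) (by decide)
        hw0 hm0 hm2 hm1 hm3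
    by_cases hm3 : m 3 = 0
    · exact h.hasHighDegreeRep_of_two_two hpos htwo hm hn0 (Equiv.swap 1 3) (by decide)
        hz0 hm0 hm3 hm2 hm1
    -- All of x₂, x₃, x₄ divide x^m, so the rest of the fibre can only be a power of x₁.
    obtain ⟨P, hP, hPw⟩ := hm.1
    have hP1 := disjoint_of_minimal_hasNonuniqueWeight hm hP hPw hm1
    have hP2 := disjoint_of_minimal_hasNonuniqueWeight hm hP hPw hm2
    have hP3 := disjoint_of_minimal_hasNonuniqueWeight hm hP hPw hm3
    refine ⟨P, Nat.pos_of_ne_zero fun hP0 => ?_, hPw,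
      monoDeg_le_of_weightOf_eq (n 0) (hpos 0) hPw.symm (fun i _ => hn0 i) fun i hi => ?_⟩
    · refine ne_zero_of_weightOf_eq hpos (u := m) (v := P) (fun h => hm1 (by simp [h])) hPw ?_
      ext i
      fin_cases i <;> assumption
    · fin_cases i
      · exact le_rfl
      all_goals contradiction

lemma IsCaseOne.last_le_monoDeg (h : IsCaseOne K n a U) (hpos : ∀ i, 0 < n i)
    (hmono : StrictMono n) : a 3 ≤ monoDeg (U 3) := by
  rw [← monoDeg_single 3 (a 3)]
  refine monoDeg_le_of_weightOf_eq (n := n) (n 3) (hpos 3) ?_ (fun i hi => ?_) fun i _ => ?_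
  · rw [h.weightOf_tail, weightOf_single]
  · rw [Finsupp.single_apply_ne_zero] at hi
    rw [hi.1]
  · exact hmono.monotone (Fin.le_last i)

end CaseOne

/-! ### A Cohen–Macaulay criterion in dimension one. -/

section CohenMacaulay

/-- By incomparability a prime over zero is minimal; a prime over a nonzero, hence maximal, prime is
maximal. -/
lemma ringKrullDimLE_one_of_isIntegral (A B : Type*) [CommRing A] [IsDomain A]
    [IsPrincipalIdealRing A] [CommRing B] [Algebra A B] [Algebra.IsIntegral A B] :
    Ring.KrullDimLE 1 B := by
  refine Ring.KrullDimLE.mk₁ fun I hI => ?_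
  by_cases h : I.comap (algebraMap A B) = ⊥
  · left
    refine ⟨⟨hI, bot_le⟩, fun J hJ hJI => ?_⟩
    by_contra hIJ
    have hlt : J < I := lt_of_le_not_ge hJI hIJ
    have := hJ.1
    have h2 := Ideal.comap_lt_comap_of_integral_mem_sdiff (R := A) (I := J) (J := I) hJI
      (Set.exists_of_ssubset hlt).choose_spec (Algebra.IsIntegral.isIntegral _)
    rw [h] at h2
    exact not_lt_bot h2
  · right
    have : (I.comap (algebraMap A B)).IsPrime := inferInstance
    exact Ideal.isMaximal_of_isIntegral_of_isMaximal_comap I (this.isMaximal h)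

lemma isCohenMacaulayLocal_of_mem_nonZeroDivisors {R : Type*} [CommRing R] [IsLocalRing R]
    [IsNoetherianRing R] [Ring.KrullDimLE 1 R] {r : R} (hr : r ∈ nonZeroDivisors R)
    (hm : r ∈ IsLocalRing.maximalIdeal R) : IsCohenMacaulayLocal R := by
  have hne : Ideal.span {r} ≠ ⊤ := by
    rwa [Ne, Ideal.span_singleton_eq_top]
  refine ⟨inferInstance, [r], by simpa using hm, ⟨?_, ?_⟩, le_antisymm ?_ ?_⟩
  · rw [RingTheory.Sequence.isWeaklyRegular_singleton_iff]
    exact Module.Flat.isSMulRegular_of_nonZeroDivisors hr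
  · simpa using hne.symm
  · have := Ideal.Quotient.nontrivial_iff.2 hne
    refine le_trans ?_ (ringKrullDim_quotient_succ_le_of_nonZeroDivisor hr)
    simpa using add_le_add_left (ringKrullDim_nonneg_of_nontrivial (R := R ⧸ Ideal.span {r})) 1
  · simpa using Ring.krullDimLE_iff.1 (inferInstance : Ring.KrullDimLE 1 R)

/-- A Noetherian ring which is integral and torsion-free over a principal ideal domain that is not
a field is Cohen–Macaulay. -/
lemma isCohenMacaulayRing_of_isIntegral (A : Type*) {B : Type*} [CommRing A] [IsDomain A]
    [IsPrincipalIdealRing A] [CommRing B] [Algebra A B] [Algebra.IsIntegral A B]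
    [IsNoetherianRing B] (hA : ¬ IsField A)
    (hreg : ∀ f : A, f ≠ 0 → algebraMap A B f ∈ nonZeroDivisors B) : IsCohenMacaulayRing B := by
  refine ⟨inferInstance, fun p hp => ?_⟩
  have hB := ringKrullDimLE_one_of_isIntegral A B
  have hq : (p.comap (algebraMap A B)).IsMaximal :=
    Ideal.isMaximal_comap_of_isIntegral_of_isMaximal p
  -- The contraction of `p` is maximal, hence nonzero as `A` is not a field; its elements supply the
  -- regular element.
  obtain ⟨f, hf, hf0⟩ := Submodule.exists_mem_ne_zero_of_ne_bot
    (Ring.ne_bot_of_isMaximal_of_not_isField hq hA)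
  have : IsNoetherianRing (Localization.AtPrime p) :=
    IsLocalization.isNoetherianRing p.primeCompl _ inferInstance
  have : Ring.KrullDimLE 1 (Localization.AtPrime p) := by
    rw [Ring.krullDimLE_iff, IsLocalization.AtPrime.ringKrullDim_eq_height p]
    exact Ideal.height_le_ringKrullDim_of_ne_top hp.ne_top |>.trans (Ring.krullDimLE_iff.1 hB)
  refine isCohenMacaulayLocal_of_mem_nonZeroDivisors
    (r := algebraMap B (Localization.AtPrime p) (algebraMap A B f)) ?_ ?_
  · exact IsLocalization.map_nonZeroDivisors_le p.primeCompl _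
      (Submonoid.mem_map_of_mem _ (hreg f hf0))
  · exact (IsLocalization.AtPrime.to_map_mem_maximal_iff _ p _).2 hf

end CohenMacaulay

/-! ### The tangent cone in terms of monomials of largest degree. -/

section TangentCone

variable {K : Type*} [Field K] {n : Fin 4 → ℕ}

lemma degree_eq_monoDeg (u : Fin 4 →₀ ℕ) : u.degree = monoDeg u :=
  Finsupp.degree_eq_sum u

/-- The monomial `x ^ u` has the largest degree among the monomials of the same weight. -/
def HasMaxDegree (n : Fin 4 → ℕ) (u : Fin 4 →₀ ℕ) : Prop :=
  ∀ v, weightOf n v = weightOf n u → monoDeg v ≤ monoDeg u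

lemma HasMaxDegree.of_weightOf_eq {u v : Fin 4 →₀ ℕ} (hu : HasMaxDegree n u)
    (hw : weightOf n v = weightOf n u) (hd : monoDeg u ≤ monoDeg v) : HasMaxDegree n v :=
  fun x hx => (hu x (hx.trans hw)).trans hd

lemma HasMaxDegree.of_add {u v : Fin 4 →₀ ℕ} (h : HasMaxDegree n (u + v)) :
    HasMaxDegree n u := by
  intro x hx
  have := h (x + v) (by rw [weightOf_add, weightOf_add, hx])
  rw [monoDeg_add, monoDeg_add] at this
  omega

open Classical in
/-- The linear map onto the associated graded ring of the semigroup ring, written in terms of the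
basis of monomials: `x ^ u` is sent to `t ^ weight u` if the degree of `x ^ u` is the largest one
in its weight, and to `0` otherwise. -/
noncomputable def maxDegreeMap (K : Type*) [Field K] (n : Fin 4 → ℕ) :
    MvPolynomial (Fin 4) K →ₗ[K] Polynomial K :=
  (basisMonomials (Fin 4) K).constr K fun u =>
    if HasMaxDegree n u then Polynomial.monomial (weightOf n u) 1 else 0

lemma maxDegreeMap_monomial_of_hasMaxDegree {u : Fin 4 →₀ ℕ} (h : HasMaxDegree n u) :
    maxDegreeMap K n (monomial u 1) = Polynomial.monomial (weightOf n u) 1 := by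
  exact ((basisMonomials (Fin 4) K).constr_basis K _ u).trans (if_pos h)

lemma maxDegreeMap_monomial_of_not_hasMaxDegree {u : Fin 4 →₀ ℕ} (h : ¬ HasMaxDegree n u) :
    maxDegreeMap K n (monomial u 1) = 0 := by
  exact ((basisMonomials (Fin 4) K).constr_basis K _ u).trans (if_neg h)

-- Makes the kernel of `maxDegreeMap` an ideal: among monomials of largest degree, whether
-- multiplying by x_i preserves that property depends only on the weight.
open Classical in
lemma maxDegreeMap_X_mul (i : Fin 4) : ∃ T : Polynomial K →ₗ[K] Polynomial K,
    ∀ g, maxDegreeMap K n (X i * g) = T (maxDegreeMap K n g) := by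
  let T : Polynomial K →ₗ[K] Polynomial K := (Polynomial.basisMonomials K).constr K fun s =>
    if ∃ u, weightOf n u = s ∧ HasMaxDegree n (u + Finsupp.single i 1) then
      Polynomial.monomial (s + n i) 1 else 0
  have hT (s) : T (Polynomial.monomial s 1) =
      if ∃ u, weightOf n u = s ∧ HasMaxDegree n (u + Finsupp.single i 1) then
        Polynomial.monomial (s + n i) 1 else 0 := by
    have := (Polynomial.basisMonomials K).constr_basis K (fun s =>
      if ∃ u, weightOf n u = s ∧ HasMaxDegree n (u + Finsupp.single i 1) then
        (Polynomial.monomial (s + n i) 1 : Polynomial K) else 0) s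
    rwa [Polynomial.coe_basisMonomials] at this
  refine ⟨T, fun g => ?_⟩
  have h : maxDegreeMap K n ∘ₗ LinearMap.mulLeft K (X i) = T ∘ₗ maxDegreeMap K n := by
    refine (basisMonomials (Fin 4) K).ext fun u => ?_
    have hX : X i * monomial u (1 : K) = monomial (u + Finsupp.single i 1) 1 := by
      rw [X, monomial_mul, one_mul, add_comm]
    simp only [coe_basisMonomials, LinearMap.comp_apply, LinearMap.mulLeft_apply, hX]
    by_cases hu : HasMaxDegree n u
    · rw [maxDegreeMap_monomial_of_hasMaxDegree hu, hT]
      by_cases hui : HasMaxDegree n (u + Finsupp.single i 1)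
      · rw [maxDegreeMap_monomial_of_hasMaxDegree hui, if_pos ⟨u, rfl, hui⟩, weightOf_add,
          weightOf_single, one_mul]
      · rw [maxDegreeMap_monomial_of_not_hasMaxDegree hui, if_neg]
        rintro ⟨v, hv, hvi⟩
        refine hui (hvi.of_weightOf_eq ?_ ?_)
        · rw [weightOf_add, weightOf_add, hv]
        · rw [monoDeg_add, monoDeg_add]
          exact Nat.add_le_add_right (hu v hv) _
    · rw [maxDegreeMap_monomial_of_not_hasMaxDegree hu,
        maxDegreeMap_monomial_of_not_hasMaxDegree fun h => hu h.of_add, map_zero]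
  exact LinearMap.congr_fun h g

lemma maxDegreeMap_mul_eq_zero (f : MvPolynomial (Fin 4) K) {g : MvPolynomial (Fin 4) K}
    (hg : maxDegreeMap K n g = 0) : maxDegreeMap K n (f * g) = 0 := by
  induction f using MvPolynomial.induction_on generalizing g with
  | C c => rw [← smul_eq_C_mul, map_smul, hg, smul_zero]
  | add p q hp hq => rw [add_mul, map_add, hp hg, hq hg, add_zero]
  | mul_X p i hp =>
    obtain ⟨T, hT⟩ := maxDegreeMap_X_mul (K := K) (n := n) i
    rw [mul_assoc]
    exact hp (by rw [hT, hg, map_zero])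

open Classical in
lemma coeff_maxDegreeMap (f : MvPolynomial (Fin 4) K) (s : ℕ) :
    (maxDegreeMap K n f).coeff s =
      ∑ u ∈ f.support, if HasMaxDegree n u ∧ weightOf n u = s then coeff u f else 0 := by
  conv_lhs => rw [f.as_sum, map_sum, Polynomial.finsetSum_coeff]
  refine Finset.sum_congr rfl fun u _ => ?_
  have h1 : monomial u (coeff u f) = coeff u f • monomial u (1 : K) := by
    rw [smul_monomial, smul_eq_mul, mul_one]
  rw [h1, map_smul, Polynomial.coeff_smul]
  by_cases hu : HasMaxDegree n u
  · simp [maxDegreeMap_monomial_of_hasMaxDegree hu, Polynomial.coeff_monomial, hu]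
  · simp [maxDegreeMap_monomial_of_not_hasMaxDegree hu, hu]

lemma sum_coeff_eq_zero_of_mem_toricIdeal {f : MvPolynomial (Fin 4) K}
    (hf : f ∈ toricIdeal K n) (s : ℕ) :
    ∑ u ∈ f.support, (if weightOf n u = s then coeff u f else 0) = 0 := by
  have h : aeval (fun i : Fin 4 => (Polynomial.X : Polynomial K) ^ n i) f = 0 := hf
  rw [f.as_sum, map_sum] at h
  simp only [aeval_monomial_weightOf] at h
  simpa [Polynomial.finsetSum_coeff, Polynomial.coeff_monomial] using
    congrArg (Polynomial.coeff · s) h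

/-- If the lowest form has a term of largest degree in weight s, every term of `f` of weight s has
that same degree, so all of them lie in the lowest form. Their coefficients sum to the coefficient
of t^s in the image of `f`, which is 0. -/
lemma maxDegreeMap_lowestForm {f : MvPolynomial (Fin 4) K} (hf : f ∈ toricIdeal K n) :
    maxDegreeMap K n (lowestForm f) = 0 := by
  classical
  set d := sInf {d : ℕ | homogeneousComponent d f ≠ 0} with hd
  have hmin (u) (hu : u ∈ f.support) : d ≤ monoDeg u := by
    refine Nat.sInf_le fun h => mem_support_iff.1 hu ?_
    simpa [coeff_homogeneousComponent, degree_eq_monoDeg] using congrArg (coeff u) h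
  ext s
  rw [coeff_maxDegreeMap, Polynomial.coeff_zero]
  by_cases hex : ∃ u ∈ (lowestForm f).support, HasMaxDegree n u ∧ weightOf n u = s
  · obtain ⟨u, hu, hum, rfl⟩ := hex
    have hud : monoDeg u = d := by
      rw [lowestForm, ← hd, mem_support_iff, coeff_homogeneousComponent, degree_eq_monoDeg] at hu
      by_contra h
      simp [h] at hu
    refine Eq.trans ?_ (sum_coeff_eq_zero_of_mem_toricIdeal hf (weightOf n u))
    refine Finset.sum_subset_zero_on_sdiff ?_ ?_ ?_
    · intro v hv
      rw [lowestForm, mem_support_iff, coeff_homogeneousComponent] at hv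
      rw [mem_support_iff]
      split_ifs at hv with h
      · exact hv
      · exact absurd rfl hv
    · intro v hv
      rw [Finset.mem_sdiff] at hv
      split_ifs with hw
      · have hvd : monoDeg v = d := le_antisymm (hud ▸ hum v hw) (hmin v hv.1)
        by_contra h
        refine hv.2 ?_
        rw [lowestForm, ← hd, mem_support_iff, coeff_homogeneousComponent, degree_eq_monoDeg,
          if_pos hvd]
        exact h
      · rfl
    · intro v hv
      have hc : coeff v (lowestForm f) = coeff v f := by
        rw [mem_support_iff, lowestForm, coeff_homogeneousComponent] at hv
        rw [lowestForm, coeff_homogeneousComponent]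
        split_ifs at hv ⊢ with h
        · rfl
        · exact absurd rfl hv
      have hvd : monoDeg v = d := by
        rw [lowestForm, ← hd, mem_support_iff, coeff_homogeneousComponent,
          degree_eq_monoDeg] at hv
        by_contra h
        simp [h] at hv
      rw [hc]
      by_cases hw : weightOf n v = weightOf n u
      · rw [if_pos ⟨hum.of_weightOf_eq hw (hud.trans hvd.symm).le, hw⟩, if_pos hw]
      · rw [if_neg fun h => hw h.2, if_neg hw]
  · push Not at hex
    exact Finset.sum_eq_zero fun u hu => if_neg fun h => hex u hu h.1 h.2

lemma maxDegreeMap_eq_zero_of_mem {g : MvPolynomial (Fin 4) K}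
    (hg : g ∈ lowestFormIdeal (toricIdeal K n)) : maxDegreeMap K n g = 0 := by
  induction hg using Submodule.span_induction with
  | mem x hx =>
    obtain ⟨f, hf, rfl⟩ := hx
    exact maxDegreeMap_lowestForm hf
  | zero => exact map_zero _
  | add x y _ _ hx hy => rw [map_add, hx, hy, add_zero]
  | smul c x _ hx => exact maxDegreeMap_mul_eq_zero c hx

lemma lowestForm_eq {f : MvPolynomial (Fin 4) K} {d : ℕ} (hd : homogeneousComponent d f ≠ 0)
    (hlt : ∀ e < d, homogeneousComponent e f = 0) : lowestForm f = homogeneousComponent d f := by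
  have : IsLeast {d : ℕ | homogeneousComponent d f ≠ 0} d :=
    ⟨hd, fun e he => not_lt.1 fun h => he (hlt e h)⟩
  rw [lowestForm, this.csInf_eq]

lemma homogeneousComponent_mono (u : Fin 4 →₀ ℕ) (d : ℕ) :
    homogeneousComponent d (mono K u) = if d = monoDeg u then mono K u else 0 := by
  have := homogeneousComponent_of_mem (m := d)
    (isHomogeneous_monomial (R := K) 1 (degree_eq_monoDeg u))
  rw [this]

lemma mono_mem_lowestFormIdeal {u v : Fin 4 →₀ ℕ} (hw : weightOf n u = weightOf n v)
    (hd : monoDeg u < monoDeg v) : mono K u ∈ lowestFormIdeal (toricIdeal K n) := by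
  refine Ideal.subset_span ⟨mono K u - mono K v, mono_sub_mem_toricIdeal.2 hw, ?_⟩
  have h : homogeneousComponent (monoDeg u) (mono K u - mono K v) = mono K u := by
    rw [map_sub, homogeneousComponent_mono, homogeneousComponent_mono, if_pos rfl, if_neg hd.ne,
      sub_zero]
  rw [lowestForm_eq (d := monoDeg u) (by simp [h]), h]
  intro e he
  rw [map_sub, homogeneousComponent_mono, homogeneousComponent_mono, if_neg he.ne,
    if_neg (he.trans hd).ne, sub_zero]

lemma mono_sub_mono_mem_lowestFormIdeal {u v : Fin 4 →₀ ℕ} (hw : weightOf n u = weightOf n v)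
    (hd : monoDeg u = monoDeg v) :
    mono K u - mono K v ∈ lowestFormIdeal (toricIdeal K n) := by
  by_cases huv : mono K u - mono K v = 0
  · rw [huv]
    exact zero_mem _
  refine Ideal.subset_span ⟨mono K u - mono K v, mono_sub_mem_toricIdeal.2 hw, ?_⟩
  have h : homogeneousComponent (monoDeg u) (mono K u - mono K v) = mono K u - mono K v := by
    rw [map_sub, homogeneousComponent_mono, homogeneousComponent_mono, if_pos rfl, if_pos hd]
  rw [lowestForm_eq (d := monoDeg u) (by rwa [h]), h]
  intro e he
  rw [map_sub, homogeneousComponent_mono, homogeneousComponent_mono, if_neg he.ne,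
    if_neg (hd ▸ he.ne), sub_zero]

open Classical in
lemma mem_lowestFormIdeal_iff {g : MvPolynomial (Fin 4) K} :
    g ∈ lowestFormIdeal (toricIdeal K n) ↔ maxDegreeMap K n g = 0 := by
  refine ⟨maxDegreeMap_eq_zero_of_mem, fun hg => ?_⟩
  -- `R` lifts t^s to a chosen monomial of largest degree. The default 0 is harmless, since
  -- `maxDegreeMap` only produces weights having such a monomial.
  let rep (s : ℕ) : MvPolynomial (Fin 4) K :=
    if h : ∃ u, HasMaxDegree n u ∧ weightOf n u = s then mono K h.choose else 0
  let R : Polynomial K →ₗ[K] MvPolynomial (Fin 4) K := (Polynomial.basisMonomials K).constr K rep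
  have hR (s) : R (Polynomial.monomial s 1) = rep s := by
    have := (Polynomial.basisMonomials K).constr_basis K rep s
    rwa [Polynomial.coe_basisMonomials] at this
  have hmono (u) : mono K u - R (maxDegreeMap K n (mono K u)) ∈
      lowestFormIdeal (toricIdeal K n) := by
    by_cases hu : HasMaxDegree n u
    · have hex : ∃ v, HasMaxDegree n v ∧ weightOf n v = weightOf n u := ⟨u, hu, rfl⟩
      rw [maxDegreeMap_monomial_of_hasMaxDegree hu, hR]
      simp only [rep, dif_pos hex]
      obtain ⟨h1, h2⟩ := hex.choose_spec
      exact mono_sub_mono_mem_lowestFormIdeal h2.symm (le_antisymm (h1 u h2.symm) (hu _ h2))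
    · rw [maxDegreeMap_monomial_of_not_hasMaxDegree hu, map_zero, sub_zero]
      simp only [HasMaxDegree, not_forall, not_le] at hu
      obtain ⟨v, hv, hd⟩ := hu
      exact mono_mem_lowestFormIdeal hv.symm hd
  have hall : ∀ f : MvPolynomial (Fin 4) K, f - R (maxDegreeMap K n f) ∈
      lowestFormIdeal (toricIdeal K n) := by
    intro f
    induction f using MvPolynomial.induction_on' with
    | monomial u c =>
      have h1 : monomial u c = c • monomial u (1 : K) := by
        rw [smul_monomial, smul_eq_mul, mul_one]
      rw [h1, map_smul, map_smul, ← smul_sub, smul_eq_C_mul]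
      exact Ideal.mul_mem_left _ _ (hmono u)
    | add p q hp hq =>
      rw [map_add, map_add, add_sub_add_comm]
      exact add_mem hp hq
  simpa [hg] using hall g

/-- A competitor of x₁x^u may be taken divisible by x₁; cancelling x₁ leaves a competitor of x^u. -/
lemma HasMaxDegree.add_single_zero
    (hrep : ∀ M N : Fin 4 →₀ ℕ, 0 < N 0 → weightOf n N = weightOf n M → HasHighDegreeRep n M)
    {u : Fin 4 →₀ ℕ} (hu : HasMaxDegree n u) : HasMaxDegree n (u + Finsupp.single 0 1) := by
  intro v hv
  obtain ⟨N, h0, hw, hd⟩ := hrep v (u + Finsupp.single 0 1) (by simp) hv.symm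
  obtain ⟨r, rfl⟩ : ∃ r, N = r + Finsupp.single 0 1 :=
    le_iff_exists_add'.1 (by simpa using Nat.succ_le_of_lt h0)
  have := hu r (by
    rw [hv, weightOf_add, weightOf_add] at hw
    exact Nat.add_right_cancel hw)
  rw [monoDeg_add] at hd ⊢
  omega

lemma maxDegreeMap_X_zero_mul
    (hrep : ∀ M N : Fin 4 →₀ ℕ, 0 < N 0 → weightOf n N = weightOf n M → HasHighDegreeRep n M)
    (g : MvPolynomial (Fin 4) K) :
    maxDegreeMap K n (X 0 * g) = Polynomial.X ^ n 0 * maxDegreeMap K n g := by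
  have h : maxDegreeMap K n ∘ₗ LinearMap.mulLeft K (X 0) =
      LinearMap.mulLeft K (Polynomial.X ^ n 0) ∘ₗ maxDegreeMap K n := by
    refine (basisMonomials (Fin 4) K).ext fun u => ?_
    have hX : X 0 * monomial u (1 : K) = monomial (u + Finsupp.single 0 1) 1 := by
      rw [X, monomial_mul, one_mul, add_comm]
    simp only [coe_basisMonomials, LinearMap.comp_apply, LinearMap.mulLeft_apply, hX]
    by_cases hu : HasMaxDegree n u
    · rw [maxDegreeMap_monomial_of_hasMaxDegree hu,
        maxDegreeMap_monomial_of_hasMaxDegree (hu.add_single_zero hrep), weightOf_add,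
        weightOf_single, one_mul, Polynomial.X_pow_mul_monomial]
    · rw [maxDegreeMap_monomial_of_not_hasMaxDegree hu,
        maxDegreeMap_monomial_of_not_hasMaxDegree fun h => hu h.of_add, mul_zero]
  exact LinearMap.congr_fun h g

/-- Carries the `K[x₁]`-action to multiplication by f(t^n₁) in the domain `K[t]`, which gives
torsion-freeness. -/
lemma maxDegreeMap_aeval_X_zero_mul
    (hrep : ∀ M N : Fin 4 →₀ ℕ, 0 < N 0 → weightOf n N = weightOf n M → HasHighDegreeRep n M)
    (f : Polynomial K) (g : MvPolynomial (Fin 4) K) :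
    maxDegreeMap K n (Polynomial.aeval (X 0 : MvPolynomial (Fin 4) K) f * g) =
      Polynomial.expand K (n 0) f * maxDegreeMap K n g := by
  induction f using Polynomial.induction_on generalizing g with
  | C c =>
    rw [Polynomial.aeval_C, Polynomial.expand_C, ← Polynomial.smul_eq_C_mul, ← map_smul,
      ← Algebra.smul_def]
  | add p q hp hq => rw [map_add, add_mul, map_add, map_add, add_mul, hp, hq]
  | monomial k c h =>
    rw [pow_succ, ← mul_assoc, map_mul (Polynomial.aeval _), Polynomial.aeval_X, mul_assoc, h,
      maxDegreeMap_X_zero_mul hrep, map_mul _ (Polynomial.C c * Polynomial.X ^ k),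
      Polynomial.expand_X, mul_assoc]

theorem hasCohenMacaulayTangentCone_of_hasHighDegreeRep (hpos : ∀ i, 0 < n i)
    (hn : ∀ i, i ≠ 0 → n 0 < n i)
    (hrep : ∀ M N : Fin 4 →₀ ℕ, 0 < N 0 → weightOf n N = weightOf n M → HasHighDegreeRep n M) :
    HasCohenMacaulayTangentCone K n := by
  set J := lowestFormIdeal (toricIdeal K n) with hJ
  let π : MvPolynomial (Fin 4) K →ₐ[K] MvPolynomial (Fin 4) K ⧸ J := Ideal.Quotient.mkₐ K J
  let φ : Polynomial K →ₐ[K] MvPolynomial (Fin 4) K ⧸ J :=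
    π.comp (Polynomial.aeval (X 0 : MvPolynomial (Fin 4) K))
  let _ : Algebra (Polynomial K) (MvPolynomial (Fin 4) K ⧸ J) := φ.toRingHom.toAlgebra
  have hmap (f) : algebraMap (Polynomial K) (MvPolynomial (Fin 4) K ⧸ J) f = φ f := rfl
  have hint : Algebra.IsIntegral (Polynomial K) (MvPolynomial (Fin 4) K ⧸ J) := by
    refine ⟨fun b => ?_⟩
    obtain ⟨g, rfl⟩ := Ideal.Quotient.mk_surjective b
    induction g using MvPolynomial.induction_on with
    | C c =>
      convert! isIntegral_algebraMap (R := Polynomial K) (x := Polynomial.C c)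
      rw [hmap]
      simp [φ, π]
    | add p q hp hq =>
      rw [map_add]
      exact hp.add hq
    | mul_X p i hp =>
      rw [map_mul]
      refine hp.mul ?_
      by_cases hi : i = 0
      · subst hi
        convert! isIntegral_algebraMap (R := Polynomial K) (x := Polynomial.X)
        rw [hmap]
        simp [φ, π]
      · refine IsIntegral.of_pow (hpos 0) ?_
        rw [← map_pow, X_pow_eq_monomial, Ideal.Quotient.eq_zero_iff_mem.2]
        · exact isIntegral_zero
        -- The lowest form of x_i^n₁ - x₁^n_i is x_i^n₁, because n₁ < n_i.
        · refine mono_mem_lowestFormIdeal (v := Finsupp.single 0 (n i)) ?_ ?_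
          · rw [weightOf_single, weightOf_single, mul_comm]
          · rw [monoDeg_single, monoDeg_single]
            exact hn i hi
  refine isCohenMacaulayRing_of_isIntegral (Polynomial K) (Polynomial.not_isField K) ?_
  intro f hf
  rw [mem_nonZeroDivisors_iff_right]
  intro b hb
  obtain ⟨g, rfl⟩ := Ideal.Quotient.mk_surjective b
  have hb' : Polynomial.aeval (X 0 : MvPolynomial (Fin 4) K) f * g ∈ J := by
    rw [← Ideal.Quotient.eq_zero_iff_mem, map_mul, mul_comm]
    exact hb
  rw [Ideal.Quotient.eq_zero_iff_mem, mem_lowestFormIdeal_iff]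
  rw [hJ, mem_lowestFormIdeal_iff, maxDegreeMap_aeval_X_zero_mul hrep] at hb'
  exact (mul_eq_zero.1 hb').resolve_left ((Polynomial.expand_ne_zero (hpos 0)).2 hf)

end TangentCone

/-! ### The three cases. -/

theorem proposition2 {K : Type*} [Field K] (n : Fin 4 → ℕ) (hpos : ∀ i, 0 < n i)
    (hgcd : Finset.univ.gcd n = 1) (hmono : StrictMono n)
    (a : Fin 4 → ℕ) (u v w z : Fin 4 →₀ ℕ)
    (hcase : IsCaseOne K n a ![u, v, w, z]) (hv : 0 ∉ monoSupp v) :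
    -- (i)
    (0 ∈ monoSupp w → 0 ∈ monoSupp z →
      a 2 ≤ monoDeg w →
      (∀ p q : Fin 4 →₀ ℕ, IsTwoTwoBinomial K n a p q → 0 ∈ monoSupp p →
        monoDeg q ≤ monoDeg p) →
      (∀ d₂ d₃ d₄ : ℕ, a 1 ≤ d₂ → d₃ < a 2 → d₄ < a 3 →
        SatisfiesDegreeCondition K n d₂ d₃ d₄) →
      HasCohenMacaulayTangentCone K n) ∧
    -- (ii)
    (0 ∈ monoSupp w → 0 ∉ monoSupp z →
      a 2 ≤ monoDeg w →
      (∀ d₂ d₃ d₄ : ℕ, d₃ < a 2 → SatisfiesDegreeCondition K n d₂ d₃ d₄) →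
      HasCohenMacaulayTangentCone K n) ∧
    -- (iii)
    (0 ∉ monoSupp w → 0 ∈ monoSupp z →
      (∀ d₂ d₃ d₄ : ℕ, d₄ < a 3 → SatisfiesDegreeCondition K n d₂ d₃ d₄) →
      HasCohenMacaulayTangentCone K n) := by
  have hlt (i : Fin 4) (hi : i ≠ 0) : n 0 < n i := hmono (Fin.pos_of_ne_zero hi)
  have hsupp (t : Fin 4 →₀ ℕ) : 0 ∈ monoSupp t ↔ 0 < t 0 := by
    simp [monoSupp, Nat.pos_iff_ne_zero]
  have hself (M : Fin 4 →₀ ℕ) (hM : M 0 ≠ 0) : HasHighDegreeRep n M :=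
    ⟨M, Nat.pos_of_ne_zero hM, rfl, le_rfl⟩
  -- No degree assumption on the tail of x₄ is needed: n₄ is the largest weight.
  have hz4 := hcase.last_le_monoDeg hpos hmono
  have hw3 := hcase.weightOf_tail 2
  have hw4 := hcase.weightOf_tail 3
  simp only [hsupp]
  refine ⟨fun hw hz hdw htwo hdeg => ?_, fun hw _ hdw hdeg => ?_, fun _ hz hdeg => ?_⟩
  all_goals
    refine hasCohenMacaulayTangentCone_of_hasHighDegreeRep hpos hlt fun M N hN hNM => ?_
    by_cases hM : M 0 ≠ 0
    · exact hself M hM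
    rw [not_not] at hM
  · by_cases h3 : a 2 ≤ M 2
    · exact hasHighDegreeRep_of_single_le hw3 hw hdw h3
    by_cases h4 : a 3 ≤ M 3
    · exact hasHighDegreeRep_of_single_le hw4 hz hz4 h4
    rw [not_le] at h3 h4
    by_cases h2 : a 1 ≤ M 1
    · exact (hdeg _ _ _ h2 h3 h4).hasHighDegreeRep hM hN hNM
    · exact hcase.hasHighDegreeRep_of_lt hpos hmono hw.ne' hz.ne'
        (fun p q hpq hp => htwo p q hpq ((hsupp p).1 hp)) hdeg hM (not_le.1 h2) h3 h4 hN hNM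
  · by_cases h3 : a 2 ≤ M 2
    · exact hasHighDegreeRep_of_single_le hw3 hw hdw h3
    · exact (hdeg _ _ _ (not_le.1 h3)).hasHighDegreeRep hM hN hNM
  · by_cases h4 : a 3 ≤ M 3
    · exact hasHighDegreeRep_of_single_le hw4 hz hz4 h4
    · exact (hdeg _ _ _ (not_le.1 h4)).hasHighDegreeRep hM hN hNM
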